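/- Let $\Gamma\subset\mathbb{R}^m\times\mathbb{R}$ be a lattice such that the two coordinate projections $p_1:\mathbb{R}^m\times\mathbb{R}\to\mathbb{R}^m$ and $p_2:\mathbb{R}^m\times\mathbb{R}\to\mathbb{R}$ are injective on $\Gamma$ and have dense images $p_1(\Gamma)$, $p_2(\Gamma)$. Let $\Omega\subset\mathbb{R}$ be a nonempty compact interval that equals the closure of its interior, is symmetric around the origin, and whose boundary contains no point of $p_2(\Gamma)$. Let $\Lambda(\Omega)=\{p_1(\gamma):\gamma\in\Gamma,\ p_2(\gamma)\in\Omega\}$ be the corresponding (simple generic) model set. Let $\Delta\subset\mathbb{R}^m$ be relatively dense and uniformly discrete, and let $g_1,\dots,g_L\in W(L^2,\ell^1)$, i.e. $\sum_{k\in\mathbb{Z}^m}\|g_l\mathbf 1_{k+[0,1]^m}\|_2<\infty$ for each $l$. Consider the Gabor system $$\mathcal G(g,\Lambda(\Omega),\Delta)=\{T_\lambda M_\beta g_l : l=1,\dots,L,\ \lambda\in\Lambda(\Omega),\ \beta\in\Delta\},$$ where $T_\lambda f(t)=f(t-\lambda)$ and $M_\beta f(t)=e^{2\pi i\beta\cdot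 t}f(t)$, and let $\widehat f(\omega)=\int_{\mathbb{R}^m}f(t)e^{-2\pi i t\cdot\omega}\,dt$. Then the density $$D(\Lambda(\Omega))=\lim_{R\to\infty}\frac{\#\big(\Lambda(\Omega)\cap(x+R[0,1]^m)\big)}{R^m}$$ exists and does not depend on $x\in\mathbb{R}^m$, and $\mathcal G(g,\Lambda(\Omega),\Delta)$ is a normalized tight frame for $L^2(\mathbb{R}^m)$ (a frame with lower and upper frame bounds both equal to $1$) if and only if it is a Bessel sequence with upper frame bound $1$, that is, $$\sum_{l=1}^L\sum_{\lambda\in\Lambda(\Omega)}\sum_{\beta\in\Delta}|\langle f,T_\lambda M_\beta g_l\rangle|^2\le\|f\|_2^2\quad\text{for all } f\in L^2(\mathbb{R}^m),$$ and $$D(\Lambda(\Omega))\sum_{l=1}^L\sum_{\beta\in\Delta}|\widehat{g}_l(t-\beta)|^2=1\quad\text{for a.e. } t\in\mathbb{R}^m.$$ -/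

import Mathlib

open MeasureTheory Filter Topology
open scoped ENNReal NNReal FourierTransform Pointwise

noncomputable section

namespace GaborModelSet

/-! ### Geometry of point sets in `ℝ^m` -/

/-- The cube `B(x, R) = x + R • [0, 1]^m`. -/
def cube {m : ℕ} (x : EuclideanSpace ℝ (Fin m)) (R : ℝ) : Set (EuclideanSpace ℝ (Fin m)) :=
  {t | ∀ i, x i ≤ t i ∧ t i ≤ x i + R}

/-- `S` is relatively dense: for some `r > 0`, every cube of side `r` meets `S`. -/
def IsRelativelyDense {m : ℕ} (S : Set (EuclideanSpace ℝ (Fin m))) : Prop :=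
  ∃ r : ℝ, 0 < r ∧ ∀ t, (S ∩ cube t r).Nonempty

/-- `S` is uniformly discrete: for some `r > 0`, distinct points of `S` have distance at
least `r`. -/
def IsUniformlyDiscrete {m : ℕ} (S : Set (EuclideanSpace ℝ (Fin m))) : Prop :=
  ∃ r : ℝ, 0 < r ∧ ∀ x ∈ S, ∀ y ∈ S, dist x y < r → x = y

/-- `S` has density `d`: for every `x`, `#(S ∩ B(x, R)) / R^m → d` as `R → ∞`. -/
def HasDensity {m : ℕ} (S : Set (EuclideanSpace ℝ (Fin m))) (d : ℝ) : Prop :=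
  ∀ x, Tendsto (fun R : ℝ => ((S ∩ cube x R).ncard : ℝ) / R ^ m) atTop (𝓝 d)

/-- The density `D(S)`, as the limit of `#(S ∩ B(0, R)) / R^m`; meaningful when `S` has a
density in the sense of `HasDensity`. -/
def density {m : ℕ} (S : Set (EuclideanSpace ℝ (Fin m))) : ℝ :=
  limUnder atTop (fun R : ℝ => ((S ∩ cube 0 R).ncard : ℝ) / R ^ m)

/-! ### Model sets -/

/-- The model set `{p₁ γ : γ ∈ Γ, p₂ γ ∈ Ω}`. -/
def modelSet {E H : Type*} [AddCommGroup E] [AddCommGroup H]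
    (Γ : Submodule ℤ (E × H)) (Ω : Set H) : Set E :=
  {x | ∃ γ ∈ Γ, γ.1 = x ∧ γ.2 ∈ Ω}

/-- Both projections are injective on `Γ` and have dense image. -/
structure IsCutAndProject {E H : Type*} [AddCommGroup E] [AddCommGroup H]
    [TopologicalSpace E] [TopologicalSpace H] (Γ : Submodule ℤ (E × H)) : Prop where
  injOn_fst : Set.InjOn Prod.fst (Γ : Set (E × H))
  dense_fst : Dense (Prod.fst '' (Γ : Set (E × H)))
  injOn_snd : Set.InjOn Prod.snd (Γ : Set (E × H))
  dense_snd : Dense (Prod.snd '' (Γ : Set (E × H)))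

/-- A window: a nonempty compact set that is the closure of its interior and has a boundary of
measure zero. -/
structure IsWindow {H : Type*} [TopologicalSpace H] [MeasureSpace H] (Ω : Set H) : Prop where
  nonempty : Ω.Nonempty
  isCompact : IsCompact Ω
  closure_interior : closure (interior Ω) = Ω
  volume_frontier : volume (frontier Ω) = 0

/-- The data of a simple (one-dimensional internal space, interval as window) generic
(no point of `p₂(Γ)` on the boundary of the window) model set whose window is symmetric around
the origin. -/
structure IsSimpleGenericSymmetric {m : ℕ} (Γ : Submodule ℤ (EuclideanSpace ℝ (Fin m) × ℝ))
    (Ω : Set ℝ) : Prop where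
  isCutAndProject : IsCutAndProject Γ
  isWindow : IsWindow Ω
  interval : Ω.OrdConnected
  symmetric : -Ω = Ω
  generic : Disjoint (frontier Ω) (Prod.snd '' (Γ : Set (EuclideanSpace ℝ (Fin m) × ℝ)))

/-! ### The amalgam space `W(L^p, ℓ^1)` -/

/-- The point of `ℝ^m` with integer coordinates `k`. -/
def intVec {m : ℕ} (k : Fin m → ℤ) : EuclideanSpace ℝ (Fin m) :=
  WithLp.toLp 2 fun i => (k i : ℝ)

/-- The norm of `W(L^p, ℓ^1)`: the sum over `k ∈ ℤ^m` of the `L^p` norms of the restrictions of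
`f` to the cubes `[0, 1]^m + k`. -/
def amalgamNorm {m : ℕ} (p : ℝ≥0∞) (f : EuclideanSpace ℝ (Fin m) → ℂ) : ℝ≥0∞ :=
  ∑' k : Fin m → ℤ, eLpNorm ((cube (intVec k) 1).indicator f) p volume

/-- Membership in `W(L^p, ℓ^1)`. -/
def MemAmalgam {m : ℕ} (p : ℝ≥0∞) (f : EuclideanSpace ℝ (Fin m) → ℂ) : Prop :=
  AEStronglyMeasurable f volume ∧ amalgamNorm p f < ∞

/-! ### Translations, modulations and Gabor systems -/

/-- The Hilbert space `L²(ℝ^m)`. -/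
abbrev L2 (m : ℕ) : Type := Lp ℂ 2 (volume : Measure (EuclideanSpace ℝ (Fin m)))

/-- Translation on `L²(ℝ^m)`: `(T_x f)(t) = f (t - x)`. -/
def translateL2 {m : ℕ} (x : EuclideanSpace ℝ (Fin m)) (f : L2 m) : L2 m :=
  Lp.compMeasurePreserving (fun t => t - x) (measurePreserving_sub_right volume x) f

theorem memLp_modulate {m : ℕ} (b : EuclideanSpace ℝ (Fin m)) (f : L2 m) :
    MemLp (fun t => Complex.exp (2 * Real.pi * Complex.I * (inner ℝ b t : ℝ)) * f t) 2
      (volume : Measure (EuclideanSpace ℝ (Fin m))) := by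
  refine (Lp.memLp f).of_le ?_ ?_
  · refine AEStronglyMeasurable.mul ?_ (Lp.aestronglyMeasurable f)
    exact Continuous.aestronglyMeasurable (by fun_prop)
  · refine Eventually.of_forall fun t => le_of_eq ?_
    have h : (2 * Real.pi * Complex.I * (inner ℝ b t : ℝ) : ℂ)
        = ((2 * Real.pi * inner ℝ b t : ℝ) : ℂ) * Complex.I := by
      push_cast
      ring
    rw [norm_mul, h, Complex.norm_exp_ofReal_mul_I, one_mul]

/-- Modulation on `L²(ℝ^m)`: `(M_b f)(t) = exp (2 π i b · t) f t`. -/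
def modulateL2 {m : ℕ} (b : EuclideanSpace ℝ (Fin m)) (f : L2 m) : L2 m :=
  (memLp_modulate b f).toLp _

/-- The Gabor system `G(g, S, Δ) = (T_x M_b g_l)`, indexed by `l`, `x ∈ S`, `b ∈ Δ`. -/
def gaborSystem {m L : ℕ} (g : Fin L → L2 m) (S Δ : Set (EuclideanSpace ℝ (Fin m))) :
    Fin L × S × Δ → L2 m :=
  fun i => translateL2 (i.2.1 : EuclideanSpace ℝ (Fin m))
    (modulateL2 (i.2.2 : EuclideanSpace ℝ (Fin m)) (g i.1))

/-! ### Frames -/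

section Frames

variable {ι V : Type*} [NormedAddCommGroup V] [InnerProductSpace ℂ V]

/-- The sum `∑ i, |⟨f, e i⟩|²`, with values in `[0, ∞]`. -/
def frameSum (e : ι → V) (f : V) : ℝ≥0∞ := ∑' i, ‖inner ℂ (e i) f‖ₑ ^ 2

/-- `e` is a Bessel sequence with upper frame bound `B`. -/
def IsBesselWith (B : ℝ≥0) (e : ι → V) : Prop :=
  ∀ f : V, frameSum e f ≤ B * ‖f‖ₑ ^ 2

/-- `e` is a frame with lower frame bound `A` and upper frame bound `B`. -/
def IsFrameWith (A B : ℝ≥0) (e : ι → V) : Prop :=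
  0 < A ∧ 0 < B ∧ ∀ f : V, A * ‖f‖ₑ ^ 2 ≤ frameSum e f ∧ frameSum e f ≤ B * ‖f‖ₑ ^ 2

/-- A normalized tight frame: a frame with both bounds equal to `1`. -/
def IsNormalizedTightFrame (e : ι → V) : Prop := IsFrameWith 1 1 e

end Frames

end GaborModelSet

end

namespace GaborModelSet

/-! ### The Fourier transform on `L¹ ∩ L²` -/

section Fourier

variable {m : ℕ}

local notation "𝔼" => EuclideanSpace ℝ (Fin m)

/-! Write `Ω = [-a, a]`, fix `f`, and put `Φ(x) = ∑ |⟨T_x f, M_b g_l⟩|²`, summed over `l` and `b ∈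
Δ`. The frame sum of `T_x f` is the slice `w = 0` of the `Γ`-periodic function `H(x, w) = ∑_γ Φ(x -
p₁γ) 1_Ω(w - p₂γ)` (`hullSum`), and the slices `w ∈ p₂(Γ)` are frame sums of other translates of
`f`. Unfolding over a fundamental domain and Plancherel (`setLIntegral_hullSum`) show that the mean
of `H` is `∫ |f̂|² · d ∑ |ĝ_l(· - b)|²`, where `d = 2a / vol(Γ)` is the density of the model set
(`hasDensity_modelSet`).

By the Bessel bound, `H` is finite and continuous in `w` away from window boundaries
(`continuousAt_hullSum`). As `p₂(Γ)` is dense, a closed condition on the frame sums of all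
translates passes to `H` a.e. (`ae_hullSum_mem`). For a tight frame, `H = ‖f‖²` a.e.; comparing
means for all `f` forces the weight to be `1`. Conversely, the Bessel bound gives `H ≤ ‖f‖²` a.e.,
and the weight condition makes the means equal, so `H = ‖f‖²` a.e. Genericity makes `w = 0` a point
of continuity, which brings the equality back to `f` itself (`le_frameSum_of_ae_hullSum`). -/

theorem continuous_fourier_of_integrable {F : EuclideanSpace ℝ (Fin m) → ℂ} (hF : Integrable F) :
    Continuous (𝓕 F) :=
  VectorFourier.fourierIntegral_continuous Real.continuous_fourierChar
    (by exact continuous_inner) hF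

/-- On `L¹ ∩ L²`, the Fourier transform of `L²` is given by the Fourier integral. -/
theorem fourier_toLp_ae_eq {F : EuclideanSpace ℝ (Fin m) → ℂ} (h1 : Integrable F)
    (h2 : MemLp F 2 volume) :
    ((𝓕 (h2.toLp F) : L2 m) : EuclideanSpace ℝ (Fin m) → ℂ) =ᵐ[volume] 𝓕 F := by
  apply ae_eq_of_integral_contDiff_smul_eq
  · exact (Lp.memLp (𝓕 (h2.toLp F))).locallyIntegrable one_le_two
  · exact (continuous_fourier_of_integrable h1).locallyIntegrable
  · intro φ φ_smooth φ_cpt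
    have hφ₁ : HasCompactSupport (Complex.ofRealCLM ∘ φ) := φ_cpt.comp_left rfl
    have hφ₂ : ContDiff ℝ ((⊤ : ℕ∞) : WithTop ℕ∞) (Complex.ofRealCLM ∘ φ) := by fun_prop
    set ψ := hφ₁.toSchwartzMap hφ₂ with hψ
    have e1 := DFunLike.congr_fun (Lp.fourier_toTemperedDistribution_eq (h2.toLp F)) ψ
    rw [TemperedDistribution.fourier_apply, Lp.toTemperedDistribution_apply,
      Lp.toTemperedDistribution_apply] at e1
    have e2 : ∫ x, (𝓕 ψ) x • (h2.toLp F) x = ∫ x, (𝓕 (ψ : 𝔼 → ℂ)) x • F x := by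
      apply integral_congr_ae
      filter_upwards [h2.coeFn_toLp] with x hx
      rw [hx, SchwartzMap.fourier_coe]
    have e3 : ∫ x, (𝓕 (ψ : 𝔼 → ℂ)) x • F x = ∫ x, ψ x • 𝓕 F x := by
      simpa using! (VectorFourier.integral_fourierIntegral_smul_eq_flip (L := innerₗ 𝔼)
        Real.continuous_fourierChar continuous_inner (ψ.integrable (μ := volume)) h1)
    have e4 := (e1.symm.trans e2).trans e3
    simpa [hψ] using e4

theorem fourier_ae_eq_of_integrable (F : L2 m) (h1 : Integrable (F : EuclideanSpace ℝ (Fin m) → ℂ)) :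
    ((𝓕 F : L2 m) : EuclideanSpace ℝ (Fin m) → ℂ) =ᵐ[volume] 𝓕 (F : 𝔼 → ℂ) := by
  have := fourier_toLp_ae_eq h1 (Lp.memLp F)
  rwa [Lp.toLp_coeFn] at this

theorem enorm_sq_eq_lintegral (F : L2 m) : ‖F‖ₑ ^ 2 = ∫⁻ x, ‖F x‖ₑ ^ 2 := by
  rw [Lp.enorm_def, eLpNorm_eq_lintegral_rpow_enorm_toReal (by simp) (by simp)]
  simp only [ENNReal.toReal_ofNat, ENNReal.rpow_ofNat]
  rw [← ENNReal.rpow_natCast, ← ENNReal.rpow_mul]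
  norm_num

/-- Plancherel's theorem for the Fourier integral on `L¹ ∩ L²`. -/
theorem lintegral_enorm_fourier_sq {F : EuclideanSpace ℝ (Fin m) → ℂ} (h1 : Integrable F)
    (h2 : MemLp F 2 volume) : ∫⁻ x, ‖𝓕 F x‖ₑ ^ 2 = ∫⁻ x, ‖F x‖ₑ ^ 2 := by
  have e1 : ∫⁻ x, ‖𝓕 F x‖ₑ ^ 2 = ‖(𝓕 (h2.toLp F) : L2 m)‖ₑ ^ 2 := by
    rw [enorm_sq_eq_lintegral]
    apply lintegral_congr_ae
    filter_upwards [fourier_toLp_ae_eq h1 h2] with x hx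
    rw [hx]
  have e2 : ∫⁻ x, ‖F x‖ₑ ^ 2 = ‖h2.toLp F‖ₑ ^ 2 := by
    rw [enorm_sq_eq_lintegral]
    apply lintegral_congr_ae
    filter_upwards [h2.coeFn_toLp] with x hx
    rw [hx]
  rw [e1, e2, ← ofReal_norm, ← ofReal_norm, Lp.norm_fourier_eq]

theorem lintegral_enorm_fourierInv_sq {F : EuclideanSpace ℝ (Fin m) → ℂ} (h1 : Integrable F)
    (h2 : MemLp F 2 volume) : ∫⁻ x, ‖𝓕⁻ F x‖ₑ ^ 2 = ∫⁻ x, ‖F x‖ₑ ^ 2 := by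
  rw [← lintegral_enorm_fourier_sq h1 h2]
  simp_rw [Real.fourierInv_eq_fourier_neg]
  exact (Measure.measurePreserving_neg (volume : Measure 𝔼)).lintegral_comp_emb
    (MeasurableEquiv.neg 𝔼).measurableEmbedding (fun x => ‖𝓕 F x‖ₑ ^ 2)

/-! ### Translations and modulations -/

theorem translateL2_coe (x : EuclideanSpace ℝ (Fin m)) (f : L2 m) :
    (translateL2 x f : 𝔼 → ℂ) =ᵐ[volume] fun t => f (t - x) :=
  Lp.coeFn_compMeasurePreserving f (measurePreserving_sub_right volume x)

theorem modulateL2_coe (b : EuclideanSpace ℝ (Fin m)) (f : L2 m) :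
    (modulateL2 b f : 𝔼 → ℂ) =ᵐ[volume]
      fun t => Complex.exp (2 * Real.pi * Complex.I * (inner ℝ b t : ℝ)) * f t :=
  (memLp_modulate b f).coeFn_toLp

theorem gaborAtom_coe (x b : EuclideanSpace ℝ (Fin m)) (f : L2 m) :
    (translateL2 x (modulateL2 b f) : 𝔼 → ℂ) =ᵐ[volume]
      fun t => Complex.exp (2 * Real.pi * Complex.I * (inner ℝ b (t - x) : ℝ)) * f (t - x) := by
  have h := (measurePreserving_sub_right volume x).quasiMeasurePreserving.ae
    (modulateL2_coe b f)
  filter_upwards [translateL2_coe x (modulateL2 b f), h] with t h1 h2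
  rw [h1, h2]

theorem norm_exp_two_pi_I (r : ℝ) : ‖Complex.exp (2 * Real.pi * Complex.I * (r : ℝ))‖ = 1 := by
  have h : (2 * Real.pi * Complex.I * (r : ℝ) : ℂ) = ((2 * Real.pi * r : ℝ) : ℂ) * Complex.I := by
    push_cast
    ring
  rw [h, Complex.norm_exp_ofReal_mul_I]

theorem integrable_gaborAtom (x b : EuclideanSpace ℝ (Fin m)) {f : L2 m}
    (hf : Integrable (f : EuclideanSpace ℝ (Fin m) → ℂ)) :
    Integrable (translateL2 x (modulateL2 b f) : EuclideanSpace ℝ (Fin m) → ℂ) := by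
  refine (hf.comp_sub_right x).mono (Lp.aestronglyMeasurable _) ?_
  filter_upwards [gaborAtom_coe x b f] with t ht
  rw [ht, norm_mul, norm_exp_two_pi_I, one_mul]

theorem fourier_gaborAtom (x b : EuclideanSpace ℝ (Fin m)) (f : L2 m)
    (w : EuclideanSpace ℝ (Fin m)) :
    𝓕 (translateL2 x (modulateL2 b f) : 𝔼 → ℂ) w
      = Complex.exp (-(2 * Real.pi * Complex.I * (inner ℝ x w : ℝ))) * 𝓕 (f : 𝔼 → ℂ) (w - b) := by
  rw [Real.fourier_congr_ae (gaborAtom_coe x b f), Real.fourier_eq', Real.fourier_eq',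
    ← integral_const_mul]
  symm
  rw [← integral_sub_right_eq_self _ x]
  congr 1
  ext t
  simp only [smul_eq_mul, inner_sub_right, inner_sub_left]
  rw [← mul_assoc, ← mul_assoc, ← Complex.exp_add, ← Complex.exp_add, real_inner_comm t b,
    real_inner_comm x b]
  congr 2
  push_cast
  ring

theorem memLp_conj_fourier_mul (b : EuclideanSpace ℝ (Fin m)) {g : L2 m}
    (hg : Integrable (g : EuclideanSpace ℝ (Fin m) → ℂ)) (f : L2 m) :
    MemLp (fun w => (starRingEnd ℂ) (𝓕 (g : 𝔼 → ℂ) (w - b)) * f w) 2 (volume : Measure 𝔼) := by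
  have hc : Continuous fun w : 𝔼 => (starRingEnd ℂ) (𝓕 (g : 𝔼 → ℂ) (w - b)) :=
    Complex.continuous_conj.comp ((continuous_fourier_of_integrable hg).comp (by fun_prop))
  refine MemLp.of_le_mul (c := ∫ t, ‖g t‖) (Lp.memLp f)
    (hc.aestronglyMeasurable.mul (Lp.aestronglyMeasurable f)) (Eventually.of_forall fun w => ?_)
  rw [norm_mul, RCLike.norm_conj]
  exact mul_le_mul_of_nonneg_right (VectorFourier.norm_fourierIntegral_le_integral_norm _ _ _ _ _)
    (norm_nonneg _)

theorem memLp_fourier_sub (b : EuclideanSpace ℝ (Fin m)) {g : L2 m}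
    (hg : Integrable (g : EuclideanSpace ℝ (Fin m) → ℂ)) :
    MemLp (fun w => 𝓕 (g : 𝔼 → ℂ) (w - b)) 2 (volume : Measure 𝔼) :=
  ((Lp.memLp (𝓕 g : L2 m)).ae_eq (fourier_ae_eq_of_integrable g hg)).comp_measurePreserving
    (measurePreserving_sub_right volume b)

theorem integrable_conj_fourier_mul (b : EuclideanSpace ℝ (Fin m)) {g : L2 m}
    (hg : Integrable (g : EuclideanSpace ℝ (Fin m) → ℂ)) (f : L2 m) :
    Integrable (fun w => (starRingEnd ℂ) (𝓕 (g : 𝔼 → ℂ) (w - b)) * f w) :=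
  MemLp.integrable_mul (memLp_fourier_sub b hg).star (Lp.memLp f)

/-- By Parseval, translation by `x` becomes a phase, so the Gabor coefficient, as a function of `x`,
is an inverse Fourier integral. Its integrand lies in `L¹ ∩ L²`, hence Plancherel applies to it. -/
theorem inner_gaborAtom (x b : EuclideanSpace ℝ (Fin m)) {g : L2 m}
    (hg : Integrable (g : EuclideanSpace ℝ (Fin m) → ℂ)) (f : L2 m) :
    inner ℂ (translateL2 x (modulateL2 b g)) f
      = 𝓕⁻ (fun w => (starRingEnd ℂ) (𝓕 (g : 𝔼 → ℂ) (w - b)) * (𝓕 f : L2 m) w) x := by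
  rw [← Lp.inner_fourier_eq, L2.inner_def, Real.fourierInv_eq']
  apply integral_congr_ae
  filter_upwards [fourier_ae_eq_of_integrable _ (integrable_gaborAtom x b hg)] with w hw
  rw [hw, fourier_gaborAtom x b g, RCLike.inner_apply, map_mul, ← Complex.exp_conj, smul_eq_mul,
    real_inner_comm x w, mul_comm, mul_assoc]
  congr 2
  have h2 : (starRingEnd ℂ) 2 = 2 := map_ofNat _ 2
  simp [h2]
  ring

/-- The mean of `|⟨f, T_x M_b g⟩|²` over all translations, in terms of the Fourier transforms. -/
theorem lintegral_inner_gaborAtom_sq (b : EuclideanSpace ℝ (Fin m)) {g : L2 m}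
    (hg : Integrable (g : EuclideanSpace ℝ (Fin m) → ℂ)) (f : L2 m) :
    ∫⁻ x, ‖inner ℂ (translateL2 x (modulateL2 b g)) f‖ₑ ^ 2
      = ∫⁻ w, ‖(𝓕 f : L2 m) w‖ₑ ^ 2 * ‖𝓕 (g : 𝔼 → ℂ) (w - b)‖ₑ ^ 2 := by
  simp_rw [inner_gaborAtom _ b hg]
  rw [lintegral_enorm_fourierInv_sq (integrable_conj_fourier_mul b hg _)
    (memLp_conj_fourier_mul b hg _)]
  simp_rw [enorm_mul, RCLike.enorm_conj, mul_pow, mul_comm]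

theorem continuous_translateL2 (f : L2 m) :
    Continuous fun x : EuclideanSpace ℝ (Fin m) => translateL2 x f := by
  let c : 𝔼 → C(𝔼, 𝔼) := fun x => ⟨fun t => t - x, by fun_prop⟩
  have hc : Continuous c :=
    ContinuousMap.continuous_of_continuous_uncurry _ (by
      change Continuous fun p : 𝔼 × 𝔼 => p.2 - p.1
      fun_prop)
  exact (continuous_const (y := f)).compMeasurePreservingLp hc
    (fun x => measurePreserving_sub_right volume x) (by simp)

theorem translateL2_zero (f : L2 m) : translateL2 0 f = f := by
  apply Lp.ext
  filter_upwards [translateL2_coe 0 f] with t ht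
  rw [ht, sub_zero]

theorem translateL2_translateL2 (x y : EuclideanSpace ℝ (Fin m)) (f : L2 m) :
    translateL2 x (translateL2 y f) = translateL2 (x + y) f := by
  apply Lp.ext
  have h := (measurePreserving_sub_right volume x).quasiMeasurePreserving.ae (translateL2_coe y f)
  filter_upwards [translateL2_coe x (translateL2 y f), h, translateL2_coe (x + y) f] with t h1 h2 h3
  rw [h1, h2, h3, sub_sub]

theorem norm_translateL2 (x : EuclideanSpace ℝ (Fin m)) (f : L2 m) : ‖translateL2 x f‖ = ‖f‖ :=
  Lp.norm_compMeasurePreserving f (measurePreserving_sub_right volume x)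

theorem enorm_translateL2 (x : EuclideanSpace ℝ (Fin m)) (f : L2 m) : ‖translateL2 x f‖ₑ = ‖f‖ₑ := by
  rw [← ofReal_norm, ← ofReal_norm, norm_translateL2]

theorem inner_translateL2_translateL2 (x : EuclideanSpace ℝ (Fin m)) (f g : L2 m) :
    inner ℂ (translateL2 x f) (translateL2 x g) = inner ℂ f g := by
  rw [L2.inner_def, L2.inner_def,
    ← integral_sub_right_eq_self (fun t => inner ℂ (f t) (g t)) x]
  apply integral_congr_ae
  filter_upwards [translateL2_coe x f, translateL2_coe x g] with t h1 h2
  rw [h1, h2]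

theorem inner_translateL2_left (x : EuclideanSpace ℝ (Fin m)) (f g : L2 m) :
    inner ℂ (translateL2 x f) g = inner ℂ f (translateL2 (-x) g) := by
  rw [← inner_translateL2_translateL2 x f, translateL2_translateL2, add_neg_cancel,
    translateL2_zero]

/-! ### Cubes and the amalgam space -/

theorem cube_eq_preimage (x : EuclideanSpace ℝ (Fin m)) (R : ℝ) :
    cube x R = (WithLp.ofLp : 𝔼 → Fin m → ℝ) ⁻¹' Set.Icc (x.ofLp) (fun i => x i + R) := by
  ext t
  simp [cube, Pi.le_def, forall_and]

theorem measurableSet_cube (x : EuclideanSpace ℝ (Fin m)) (R : ℝ) : MeasurableSet (cube x R) := by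
  rw [cube_eq_preimage]
  exact (PiLp.volume_preserving_ofLp (Fin m)).measurable measurableSet_Icc

theorem volume_cube (x : EuclideanSpace ℝ (Fin m)) (R : ℝ) :
    volume (cube x R) = ENNReal.ofReal R ^ m := by
  rw [cube_eq_preimage, (PiLp.volume_preserving_ofLp (Fin m)).measure_preimage
    measurableSet_Icc.nullMeasurableSet, Real.volume_Icc_pi]
  simp

/-- On a cube of unit volume the `L¹` norm is at most the `L²` norm. Integrability makes each `ĝ_l`
a bounded continuous function. -/
theorem MemAmalgam.integrable {f : EuclideanSpace ℝ (Fin m) → ℂ} (hf : MemAmalgam 2 f) :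
    Integrable f := by
  refine ⟨hf.1, ?_⟩
  have hcov : (⋃ k : Fin m → ℤ, cube (intVec k) 1) = (Set.univ : Set 𝔼) := by
    refine Set.eq_univ_of_forall fun t => Set.mem_iUnion.2 ⟨fun i => ⌊t i⌋, fun i => ?_⟩
    exact ⟨Int.floor_le _, (Int.lt_floor_add_one _).le⟩
  calc ∫⁻ t, ‖f t‖ₑ = ∫⁻ t in ⋃ k : Fin m → ℤ, cube (intVec k) 1, ‖f t‖ₑ := by
        rw [hcov, Measure.restrict_univ]
    _ ≤ ∑' k : Fin m → ℤ, ∫⁻ t in cube (intVec k) 1, ‖f t‖ₑ := lintegral_iUnion_le _ _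
    _ ≤ amalgamNorm 2 f := by
        refine ENNReal.tsum_le_tsum fun k => ?_
        rw [eLpNorm_indicator_eq_eLpNorm_restrict (measurableSet_cube _ _),
          ← eLpNorm_one_eq_lintegral_enorm]
        have h := eLpNorm_le_eLpNorm_mul_rpow_measure_univ
          (μ := volume.restrict (cube (intVec k : 𝔼) 1)) (p := 1) (q := 2) one_le_two
          hf.1.restrict
        simpa [volume_cube] using h
    _ < ∞ := hf.2

end Fourier

/-! ### Periodization over a lattice -/

section Periodization

variable {V : Type*} [NormedAddCommGroup V]

/-- The periodization `v ↦ ∑ γ ∈ Γ, H (v - γ)`. -/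
noncomputable def periodize (Γ : Submodule ℤ V) (H : V → ℝ≥0∞) (v : V) : ℝ≥0∞ := ∑' γ : Γ, H (v - γ)

theorem periodize_add (Γ : Submodule ℤ V) (H : V → ℝ≥0∞) (v : V) (δ : Γ) :
    periodize Γ H (v + δ) = periodize Γ H v := by
  rw [periodize, periodize, ← (Equiv.addRight δ).tsum_eq]
  congr 1
  ext γ
  simp

variable [NormedSpace ℝ V] [FiniteDimensional ℝ V] [MeasurableSpace V] [BorelSpace V]
  (Γ : Submodule ℤ V) [DiscreteTopology Γ] [IsZLattice ℝ Γ]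

variable (μ : Measure V) [μ.IsAddHaarMeasure]

/-- A bounded fundamental domain of the lattice `Γ`. -/
theorem exists_fundamentalDomain :
    ∃ D : Set V, IsAddFundamentalDomain Γ D μ ∧ μ D ≠ 0 ∧ μ D ≠ ∞ ∧ Bornology.IsBounded D ∧
      ∀ v : V, ∃ γ : Γ, v - γ ∈ D := by
  have : Module.Finite ℤ Γ := ZLattice.module_finite ℝ Γ
  have : Module.Free ℤ Γ := ZLattice.module_free ℝ Γ
  let b := Module.Free.chooseBasis ℤ Γ
  refine ⟨ZSpan.fundamentalDomain (b.ofZLatticeBasis ℝ), ZLattice.isAddFundamentalDomain b μ,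
    ZSpan.measure_fundamentalDomain_ne_zero _,
    (ZSpan.fundamentalDomain_isBounded _).measure_lt_top.ne,
    ZSpan.fundamentalDomain_isBounded _, fun v => ?_⟩
  obtain ⟨δ, hδ, -⟩ := ZSpan.exist_unique_vadd_mem_fundamentalDomain (b.ofZLatticeBasis ℝ) v
  have hmem : (δ : V) ∈ Γ := (b.ofZLatticeBasis_span ℝ).le δ.2
  refine ⟨-⟨δ, hmem⟩, ?_⟩
  simpa [Submodule.vadd_def, add_comm] using hδ

variable {Γ μ}

/-- Unfolding: the integral of a periodization over a fundamental domain. -/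
theorem setLIntegral_periodize {D : Set V} (hD : IsAddFundamentalDomain Γ D μ)
    {H : V → ℝ≥0∞} (hH : Measurable H) :
    ∫⁻ v in D, periodize Γ H v ∂μ = ∫⁻ v, H v ∂μ := by
  have : MeasurableVAdd Γ V := (inferInstance : MeasurableVAdd Γ.toAddSubgroup V)
  have : VAddInvariantMeasure Γ V μ :=
    (inferInstance : VAddInvariantMeasure Γ.toAddSubgroup V μ)
  rw [hD.lintegral_eq_tsum' H]
  unfold periodize
  rw [lintegral_tsum fun γ : Γ =>
    (show Measurable fun v : V => H (v - γ) from hH.comp (measurable_id.sub_const _)).aemeasurable]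
  congr 1
  ext γ
  simp [Submodule.vadd_def, sub_eq_neg_add]

/-- A `Γ`-invariant property that holds a.e. on a fundamental domain holds a.e. -/
theorem ae_of_ae_fundamentalDomain {D : Set V} (hD : IsAddFundamentalDomain Γ D μ) {p : V → Prop}
    (hp : ∀ v, ∀ δ : Γ, p (v + δ) ↔ p v) (h : ∀ᵐ v ∂μ.restrict D, p v) : ∀ᵐ v ∂μ, p v := by
  have : MeasurableVAdd Γ V := (inferInstance : MeasurableVAdd Γ.toAddSubgroup V)
  have : VAddInvariantMeasure Γ V μ :=
    (inferInstance : VAddInvariantMeasure Γ.toAddSubgroup V μ)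
  refine hD.measure_zero_of_invariant {v | ¬ p v} (fun δ => ?_) ?_
  · ext v
    rw [Set.mem_vadd_set_iff_neg_vadd_mem]
    have := hp v (-δ)
    simp only [Set.mem_ofPred_eq, Submodule.vadd_def, vadd_eq_add, add_comm _ v]
    rw [this]
  · rw [ae_iff, Measure.restrict_apply₀'] at h
    · exact h
    · exact hD.nullMeasurableSet

end Periodization

/-! ### The density of a model set -/

section Density

variable {m : ℕ} {Γ : Submodule ℤ (EuclideanSpace ℝ (Fin m) × ℝ)}

local notation "𝔼" => EuclideanSpace ℝ (Fin m)

instance isAddHaarMeasure_volume_prod :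
    (volume : Measure (EuclideanSpace ℝ (Fin m) × ℝ)).IsAddHaarMeasure := by
  rw [Measure.volume_eq_prod]
  infer_instance

/-- A lattice shift brings `v` into a bounded domain. There the second coordinate is within `ε` of
one of finitely many points of the dense set `p₂(Γ)`, and `C` absorbs their first coordinates. -/
theorem exists_mem_close [DiscreteTopology Γ] [IsZLattice ℝ Γ]
    (hΓ : Dense (Prod.snd '' (Γ : Set (EuclideanSpace ℝ (Fin m) × ℝ)))) {ε : ℝ} (hε : 0 < ε) :
    ∃ C : ℝ, 0 ≤ C ∧ ∀ v : EuclideanSpace ℝ (Fin m) × ℝ, ∃ γ : Γ,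
      ‖v.1 - (γ : 𝔼 × ℝ).1‖ ≤ C ∧ |v.2 - (γ : 𝔼 × ℝ).2| ≤ ε := by
  obtain ⟨D, -, -, -, hDb, hD⟩ := exists_fundamentalDomain Γ (volume : Measure (𝔼 × ℝ))
  obtain ⟨K, hK⟩ := hDb.exists_norm_le
  obtain ⟨t, ht⟩ := (isCompact_Icc (a := -K) (b := K)).elim_finite_subcover
    (fun γ : Γ => Metric.ball (γ : 𝔼 × ℝ).2 ε) (fun _ => Metric.isOpen_ball) (fun s _ => by
      obtain ⟨_, h, ⟨γ, hγ, rfl⟩⟩ := Metric.dense_iff.1 hΓ s ε hε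
      exact Set.mem_iUnion.2 ⟨⟨γ, hγ⟩, Metric.mem_ball_comm.1 h⟩)
  have hS : 0 ≤ ∑ γ ∈ t, ‖(γ : 𝔼 × ℝ).1‖ := Finset.sum_nonneg fun _ _ => norm_nonneg _
  refine ⟨|K| + ∑ γ ∈ t, ‖(γ : 𝔼 × ℝ).1‖, by positivity, fun v => ?_⟩
  obtain ⟨γ₀, h₀⟩ := hD v
  have hn := hK _ h₀
  have h1 : ‖v.1 - (γ₀ : 𝔼 × ℝ).1‖ ≤ K := (norm_fst_le _).trans hn
  have h2 : |v.2 - (γ₀ : 𝔼 × ℝ).2| ≤ K := (norm_snd_le _).trans hn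
  obtain ⟨γ, hγt, hγ⟩ := Set.mem_iUnion₂.1 (ht (abs_le.1 h2))
  refine ⟨γ₀ + γ, ?_, ?_⟩
  · have h3 : ‖(γ : 𝔼 × ℝ).1‖ ≤ ∑ γ ∈ t, ‖(γ : 𝔼 × ℝ).1‖ :=
      Finset.single_le_sum (f := fun γ : Γ => ‖(γ : 𝔼 × ℝ).1‖) (fun _ _ => norm_nonneg _) hγt
    calc ‖v.1 - ((γ₀ + γ : Γ) : 𝔼 × ℝ).1‖ = ‖(v.1 - (γ₀ : 𝔼 × ℝ).1) - (γ : 𝔼 × ℝ).1‖ := by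
          simp [sub_sub]
      _ ≤ ‖v.1 - (γ₀ : 𝔼 × ℝ).1‖ + ‖(γ : 𝔼 × ℝ).1‖ := norm_sub_le _ _
      _ ≤ _ := add_le_add (h1.trans (le_abs_self K)) h3
  · rw [Metric.mem_ball, Real.dist_eq] at hγ
    simpa [sub_sub] using hγ.le

/-- The number of `γ ∈ Γ` with `γ - v ∈ B`. -/
noncomputable def boxCount (Γ : Submodule ℤ (EuclideanSpace ℝ (Fin m) × ℝ))
    (B : Set (EuclideanSpace ℝ (Fin m) × ℝ)) : EuclideanSpace ℝ (Fin m) × ℝ → ℝ≥0∞ :=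
  periodize Γ fun u => B.indicator 1 (-u)

theorem boxCount_apply (B : Set (EuclideanSpace ℝ (Fin m) × ℝ))
    (v : EuclideanSpace ℝ (Fin m) × ℝ) :
    boxCount Γ B v = ∑' γ : Γ, B.indicator 1 ((γ : 𝔼 × ℝ) - v) := by
  simp [boxCount, periodize]

theorem setLIntegral_boxCount [DiscreteTopology Γ] [IsZLattice ℝ Γ]
    {D : Set (EuclideanSpace ℝ (Fin m) × ℝ)} (hD : IsAddFundamentalDomain Γ D volume)
    {B : Set (EuclideanSpace ℝ (Fin m) × ℝ)} (hB : MeasurableSet B) :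
    ∫⁻ v in D, boxCount Γ B v = volume B := by
  have hm : Measurable fun u : 𝔼 × ℝ => B.indicator (1 : 𝔼 × ℝ → ℝ≥0∞) u :=
    measurable_one.indicator hB
  have hm' : Measurable fun u : 𝔼 × ℝ => B.indicator (1 : 𝔼 × ℝ → ℝ≥0∞) (-u) :=
    hm.comp measurable_neg
  rw [boxCount, setLIntegral_periodize hD hm']
  have := (Measure.measurePreserving_neg (volume : Measure (𝔼 × ℝ))).lintegral_comp hm
  rw [this, lintegral_indicator_one hB]

/-- A lattice shift of `v` leaves the count unchanged and brings `v` close to `v'`; the remaining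
displacement is absorbed by passing from `B` to `B'`. -/
theorem boxCount_le_boxCount [DiscreteTopology Γ] [IsZLattice ℝ Γ]
    {B B' : Set (EuclideanSpace ℝ (Fin m) × ℝ)} {C ε : ℝ}
    (hC : ∀ v : EuclideanSpace ℝ (Fin m) × ℝ, ∃ γ : Γ,
      ‖v.1 - (γ : EuclideanSpace ℝ (Fin m) × ℝ).1‖ ≤ C ∧
        |v.2 - (γ : EuclideanSpace ℝ (Fin m) × ℝ).2| ≤ ε)
    (hB : ∀ u e : EuclideanSpace ℝ (Fin m) × ℝ, ‖e.1‖ ≤ C → |e.2| ≤ ε → u + e ∈ B → u ∈ B')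
    (v v' : EuclideanSpace ℝ (Fin m) × ℝ) : boxCount Γ B v ≤ boxCount Γ B' v' := by
  obtain ⟨δ, h1, h2⟩ := hC (v' - v)
  rw [← periodize_add Γ _ v δ |> (show boxCount Γ B (v + δ) = boxCount Γ B v from ·),
    boxCount_apply, boxCount_apply]
  refine ENNReal.tsum_le_tsum fun γ => ?_
  by_cases h : (γ : 𝔼 × ℝ) - (v + δ) ∈ B
  · have h' : (γ : 𝔼 × ℝ) - v' ∈ B' := hB _ (v' - v - δ) h1 h2 (by
      convert h using 1
      abel)
    simp [h, h']
  · simp [h]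

/-- The box `[-r, R + r]^m × [-s, s]`. -/
def box (m : ℕ) (r R s : ℝ) : Set (EuclideanSpace ℝ (Fin m) × ℝ) :=
  cube (WithLp.toLp 2 fun _ => -r) (R + 2 * r) ×ˢ Set.Icc (-s) s

theorem measurableSet_box (r R s : ℝ) : MeasurableSet (box m r R s) :=
  (measurableSet_cube _ _).prod measurableSet_Icc

theorem volume_box (r R s : ℝ) :
    volume (box m r R s) = ENNReal.ofReal (R + 2 * r) ^ m * ENNReal.ofReal (2 * s) := by
  rw [box, Measure.volume_eq_prod, Measure.prod_prod, volume_cube, Real.volume_Icc]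
  congr 2
  ring

theorem mem_box_of_add_mem {r R s C ε : ℝ} (u e : EuclideanSpace ℝ (Fin m) × ℝ)
    (h1 : ‖e.1‖ ≤ C) (h2 : |e.2| ≤ ε) (h : u + e ∈ box m r R s) :
    u ∈ box m (r + C) R (s + ε) := by
  obtain ⟨ha, hb⟩ := h
  refine ⟨fun i => ?_, ?_⟩
  · have h3 := abs_le.1 (((Real.norm_eq_abs _).symm.le.trans (PiLp.norm_apply_le e.1 i)).trans h1)
    have h4 := ha i
    simp only [Prod.fst_add, PiLp.add_apply] at h4
    constructor <;> simp only <;> linarith [h3.1, h3.2, h4.1, h4.2]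
  · have h3 := abs_le.1 h2
    simp only [Prod.snd_add, Set.mem_Icc] at hb
    constructor <;> linarith [h3.1, h3.2, hb.1, hb.2]

/-- The count at `v` is at most the count of an enlarged box at every `v'`, and the latter
integrates over `D` to exactly the volume of that box. -/
theorem boxCount_mul_le [DiscreteTopology Γ] [IsZLattice ℝ Γ]
    {D : Set (EuclideanSpace ℝ (Fin m) × ℝ)} (hD : IsAddFundamentalDomain Γ D volume)
    {C ε : ℝ}
    (hC : ∀ v : EuclideanSpace ℝ (Fin m) × ℝ, ∃ γ : Γ,
      ‖v.1 - (γ : EuclideanSpace ℝ (Fin m) × ℝ).1‖ ≤ C ∧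
        |v.2 - (γ : EuclideanSpace ℝ (Fin m) × ℝ).2| ≤ ε)
    (R a : ℝ) (v : EuclideanSpace ℝ (Fin m) × ℝ) :
    boxCount Γ (box m 0 R a) v * volume D
      ≤ ENNReal.ofReal (R + 2 * C) ^ m * ENNReal.ofReal (2 * (a + ε)) := by
  rw [← volume_box, ← setLIntegral_boxCount hD (measurableSet_box _ _ _), ← setLIntegral_const]
  refine lintegral_mono fun v' => boxCount_le_boxCount hC (fun u e h1 h2 h => ?_) v v'
  simpa using mem_box_of_add_mem u e h1 h2 h

theorem le_boxCount_mul [DiscreteTopology Γ] [IsZLattice ℝ Γ]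
    {D : Set (EuclideanSpace ℝ (Fin m) × ℝ)} (hD : IsAddFundamentalDomain Γ D volume)
    {C ε : ℝ}
    (hC : ∀ v : EuclideanSpace ℝ (Fin m) × ℝ, ∃ γ : Γ,
      ‖v.1 - (γ : EuclideanSpace ℝ (Fin m) × ℝ).1‖ ≤ C ∧
        |v.2 - (γ : EuclideanSpace ℝ (Fin m) × ℝ).2| ≤ ε)
    (R a : ℝ) (v : EuclideanSpace ℝ (Fin m) × ℝ) :
    ENNReal.ofReal (R - 2 * C) ^ m * ENNReal.ofReal (2 * (a - ε))
      ≤ boxCount Γ (box m 0 R a) v * volume D := by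
  -- The negative margin `-C` shrinks the box, so that enlarging it by `C` and `ε` gives back the
  -- original one.
  have hvol := volume_box (m := m) (-C) R (a - ε)
  rw [show R + 2 * -C = R - 2 * C by ring] at hvol
  rw [← hvol, ← setLIntegral_boxCount hD (measurableSet_box _ _ _), ← setLIntegral_const]
  refine lintegral_mono fun v' => boxCount_le_boxCount hC (fun u e h1 h2 h => ?_) v' v
  simpa using mem_box_of_add_mem u e h1 h2 h

theorem boxCount_eq_encard (hinj : Set.InjOn Prod.fst (Γ : Set (EuclideanSpace ℝ (Fin m) × ℝ)))
    (x : EuclideanSpace ℝ (Fin m)) (R a : ℝ) :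
    boxCount Γ (box m 0 R a) (x, 0)
      = ((modelSet Γ (Set.Icc (-a) a) ∩ cube x R).encard : ℝ≥0∞) := by
  have himg : modelSet Γ (Set.Icc (-a) a) ∩ cube x R
      = (fun γ : Γ => (γ : 𝔼 × ℝ).1) '' {γ : Γ | (γ : 𝔼 × ℝ) - (x, 0) ∈ box m 0 R a} := by
    ext y
    simp only [modelSet, box, cube, Set.mem_inter_iff, Set.mem_ofPred_eq, Set.mem_image,
      Set.mem_prod, Prod.fst_sub, Prod.snd_sub, sub_zero, neg_zero, mul_zero, add_zero,
      PiLp.sub_apply, Subtype.exists, zero_add]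
    constructor
    · rintro ⟨⟨γ, hγ, rfl, h2⟩, h3⟩
      exact ⟨γ, hγ, ⟨fun i => ⟨by linarith [(h3 i).1], by linarith [(h3 i).2]⟩, h2⟩, rfl⟩
    · rintro ⟨γ, hγ, ⟨h3, h2⟩, rfl⟩
      exact ⟨⟨γ, hγ, rfl, h2⟩, fun i => ⟨by linarith [(h3 i).1], by linarith [(h3 i).2]⟩⟩
  have hinj' : Function.Injective fun γ : Γ => (γ : 𝔼 × ℝ).1 :=
    fun γ δ h => Subtype.ext (hinj γ.2 δ.2 h)
  rw [himg, hinj'.encard_image, ← ENNReal.tsum_set_one, boxCount_apply, tsum_subtype _ fun _ => (1 : ℝ≥0∞)]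
  rfl

/-- The model set of a lattice `Γ` with window `[-a, a]` has density `2 a / vol(Γ)`. -/
theorem hasDensity_modelSet [DiscreteTopology Γ] [IsZLattice ℝ Γ] (hΓ : IsCutAndProject Γ)
    {D : Set (EuclideanSpace ℝ (Fin m) × ℝ)} (hD : IsAddFundamentalDomain Γ D volume)
    (h0 : volume D ≠ 0) (htop : volume D ≠ ∞) {a : ℝ} (ha : 0 < a) :
    HasDensity (modelSet Γ (Set.Icc (-a) a)) (2 * a / volume.real D) := by
  intro x
  set c := volume.real D with hc
  have hcpos : 0 < c := ENNReal.toReal_pos h0 htop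
  have hcount : ∀ R : ℝ, ((modelSet Γ (Set.Icc (-a) a) ∩ cube x R).ncard : ℝ) * c
      = (boxCount Γ (box m 0 R a) (x, 0) * volume D).toReal := fun R => by
    rw [boxCount_eq_encard hΓ.injOn_fst, ENNReal.toReal_mul, Set.ncard_def, hc, measureReal_def]
    congr 1
    -- An infinite cardinality gives `0` on both sides.
    cases (modelSet Γ (Set.Icc (-a) a) ∩ cube x R).encard <;> simp
  have hlim : ∀ C s : ℝ, Tendsto (fun R : ℝ => ((R + C) / R) ^ m * s) atTop (𝓝 s) := fun C s => by
    have h1 : Tendsto (fun R : ℝ => (R + C) / R) atTop (𝓝 1) := by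
      have h2 : Tendsto (fun R : ℝ => 1 + C / R) atTop (𝓝 (1 + 0)) :=
        tendsto_const_nhds.add (tendsto_id.const_div_atTop C)
      rw [add_zero] at h2
      refine h2.congr' ?_
      filter_upwards [eventually_gt_atTop 0] with R hR
      field_simp
    simpa using (h1.pow m).mul_const s
  suffices h : Tendsto (fun R : ℝ => ((modelSet Γ (Set.Icc (-a) a) ∩ cube x R).ncard : ℝ) * c
      / R ^ m) atTop (𝓝 (2 * a)) by
    refine (h.div_const c).congr fun R => ?_
    field_simp
  -- `C` depends on `ε`, but with `ε` fixed the ratio `(R ± 2C) / R` tends to `1`, so only the error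
  -- `ε` in the window length remains.
  rw [tendsto_order]
  constructor
  · intro l hl
    obtain ⟨ε, hε, hεa, hεl⟩ : ∃ ε : ℝ, 0 < ε ∧ ε < a ∧ l < 2 * (a - ε) := by
      refine ⟨min (a / 2) ((2 * a - l) / 4), by
        apply lt_min <;> linarith, (min_le_left _ _).trans_lt (by linarith), ?_⟩
      have := min_le_right (a / 2) ((2 * a - l) / 4)
      linarith
    obtain ⟨C, hC0, hC⟩ := exists_mem_close hΓ.dense_snd hε
    filter_upwards [(hlim (-(2 * C)) (2 * (a - ε))).eventually_const_lt hεl,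
      eventually_gt_atTop (2 * C)] with R hR hRC
    refine hR.trans_le ?_
    have hR0 : 0 < R := by linarith
    rw [hcount, div_pow, div_mul_eq_mul_div]
    refine div_le_div_of_nonneg_right ?_ (by positivity)
    have h := ENNReal.toReal_mono ((boxCount_mul_le hD hC R a (x, 0)).trans_lt (by finiteness)).ne
      (le_boxCount_mul hD hC R a (x, 0))
    rw [ENNReal.toReal_mul, ENNReal.toReal_pow, ENNReal.toReal_ofReal (by linarith),
      ENNReal.toReal_ofReal (by linarith)] at h
    simpa [sub_eq_add_neg] using h
  · intro u hu
    obtain ⟨ε, hε, hεu⟩ : ∃ ε : ℝ, 0 < ε ∧ 2 * (a + ε) < u :=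
      ⟨(u - 2 * a) / 4, by linarith, by linarith⟩
    obtain ⟨C, hC0, hC⟩ := exists_mem_close hΓ.dense_snd hε
    filter_upwards [(hlim (2 * C) (2 * (a + ε))).eventually_lt_const hεu,
      eventually_gt_atTop 0] with R hR hR0
    refine lt_of_le_of_lt ?_ hR
    rw [hcount, div_pow, div_mul_eq_mul_div]
    refine div_le_div_of_nonneg_right ?_ (by positivity)
    have h := ENNReal.toReal_mono (by finiteness) (boxCount_mul_le hD hC R a (x, 0))
    rwa [ENNReal.toReal_mul (a := _ ^ m), ENNReal.toReal_pow, ENNReal.toReal_ofReal (by linarith),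
      ENNReal.toReal_ofReal (by linarith)] at h

theorem HasDensity.density_eq {S : Set (EuclideanSpace ℝ (Fin m))} {d : ℝ} (h : HasDensity S d) :
    density S = d :=
  (h 0).limUnder_eq

end Density

/-! ### Bessel sequences -/

section Bessel

variable {ι V : Type*} [NormedAddCommGroup V] [InnerProductSpace ℂ V]

/-- The square root of the frame sum satisfies the triangle inequality. -/
theorem sqrt_frameSum_add_le (e : ι → V) (f h : V) :
    frameSum e (f + h) ^ (2⁻¹ : ℝ) ≤ frameSum e f ^ (2⁻¹ : ℝ) + frameSum e h ^ (2⁻¹ : ℝ) := by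
  -- The square root is the `L²` norm of the coefficients for counting measure, so Minkowski's
  -- inequality applies.
  let _ : MeasurableSpace ι := ⊤
  have key : ∀ k : V, frameSum e k ^ (2⁻¹ : ℝ)
      = eLpNorm (fun i => (inner ℂ (e i) k : ℂ)) 2 Measure.count := fun k => by
    rw [eLpNorm_eq_lintegral_rpow_enorm_toReal (by simp) (by simp), lintegral_count, frameSum]
    simp
  have hmeas : ∀ k : V, AEStronglyMeasurable (fun i => (inner ℂ (e i) k : ℂ)) Measure.count :=
    fun k => (measurable_from_top (f := fun i => (inner ℂ (e i) k : ℂ))).aestronglyMeasurable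
  rw [key, key, key]
  refine (le_of_eq ?_).trans (eLpNorm_add_le (hmeas f) (hmeas h) one_le_two)
  congr 1
  ext i
  simp

theorem IsBesselWith.sqrt_frameSum_le {e : ι → V} (he : IsBesselWith 1 e) (f : V) :
    frameSum e f ^ (2⁻¹ : ℝ) ≤ ‖f‖ₑ := by
  have h := he f
  rw [ENNReal.coe_one, one_mul] at h
  calc frameSum e f ^ (2⁻¹ : ℝ) ≤ (‖f‖ₑ ^ 2) ^ (2⁻¹ : ℝ) := by gcongr
    _ = ‖f‖ₑ := by
      rw [← ENNReal.rpow_natCast, ← ENNReal.rpow_mul]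
      norm_num

theorem isNormalizedTightFrame_iff {e : ι → V} :
    IsNormalizedTightFrame e ↔ ∀ f, frameSum e f = ‖f‖ₑ ^ 2 := by
  simp only [IsNormalizedTightFrame, IsFrameWith, zero_lt_one, ENNReal.coe_one, one_mul, true_and]
  exact forall_congr' fun f => ⟨fun h => le_antisymm h.2 h.1, fun h => ⟨h.ge, h.le⟩⟩

end Bessel

/-! ### The hull sum: finiteness and continuity -/

section

variable {m L : ℕ}

local notation "𝔼" => EuclideanSpace ℝ (Fin m)

theorem IsUniformlyDiscrete.countable {S : Set (EuclideanSpace ℝ (Fin m))}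
    (hS : IsUniformlyDiscrete S) : S.Countable := by
  obtain ⟨r, hr, h⟩ := hS
  refine Set.PairwiseDisjoint.countable_of_isOpen (s := fun x : 𝔼 => Metric.ball x (r / 2))
    (fun x hx y hy hxy => ?_) (fun _ _ => Metric.isOpen_ball)
    (fun x _ => ⟨x, Metric.mem_ball_self (by positivity)⟩)
  refine Metric.ball_disjoint_ball ?_
  by_contra hlt
  exact hxy (h x hx y hy (by linarith))

/-- The modulations `M_b g_l`, indexed by `l` and `b ∈ Δ`. -/
noncomputable def modulates (g : Fin L → L2 m) (Δ : Set (EuclideanSpace ℝ (Fin m))) :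
    Fin L × Δ → L2 m :=
  fun p => modulateL2 (p.2 : EuclideanSpace ℝ (Fin m)) (g p.1)

theorem frameSum_gaborSystem (g : Fin L → L2 m) (S Δ : Set (EuclideanSpace ℝ (Fin m)))
    (f : L2 m) :
    frameSum (gaborSystem g S Δ) f
      = ∑' x : S, frameSum (modulates g Δ) (translateL2 (-(x : EuclideanSpace ℝ (Fin m))) f) := by
  simp only [frameSum, gaborSystem, modulates, ENNReal.tsum_prod', inner_translateL2_left]
  rw [ENNReal.tsum_comm]

variable (g : Fin L → L2 m) (Δ : Set (EuclideanSpace ℝ (Fin m)))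
  (Γ : Submodule ℤ (EuclideanSpace ℝ (Fin m) × ℝ))

/-- The extension of `x ↦ ∑ λ ∈ Λ([-s, s]), ∑ l, ∑ b, |⟨T_x f, T_λ M_b g_l⟩|²` to a
`Γ`-periodic function on `ℝ^m × ℝ`. -/
noncomputable def hullSum (s : ℝ) (f : L2 m) : EuclideanSpace ℝ (Fin m) × ℝ → ℝ≥0∞ :=
  periodize Γ fun u => frameSum (modulates g Δ) (translateL2 u.1 f) *
    (Set.Icc (-s) s).indicator 1 u.2

variable {g Δ Γ}

theorem hullSum_zero (hinj : Set.InjOn Prod.fst (Γ : Set (EuclideanSpace ℝ (Fin m) × ℝ)))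
    (s : ℝ) (f : L2 m) (x : EuclideanSpace ℝ (Fin m)) :
    hullSum g Δ Γ s f (x, 0)
      = frameSum (gaborSystem g (modelSet Γ (Set.Icc (-s) s)) Δ) (translateL2 x f) := by
  have himg : modelSet Γ (Set.Icc (-s) s)
      = (fun γ : Γ => (γ : 𝔼 × ℝ).1) '' {γ : Γ | (γ : 𝔼 × ℝ).2 ∈ Set.Icc (-s) s} := by
    ext y
    constructor
    · rintro ⟨γ, hγ, rfl, h⟩
      exact ⟨⟨γ, hγ⟩, h, rfl⟩
    · rintro ⟨γ, h, rfl⟩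
      exact ⟨γ, γ.2, rfl, h⟩
  have hinj' : Function.Injective fun γ : Γ => (γ : 𝔼 × ℝ).1 :=
    fun γ δ h => Subtype.ext (hinj γ.2 δ.2 h)
  rw [frameSum_gaborSystem, himg,
    tsum_image (fun y : 𝔼 => frameSum (modulates g Δ) (translateL2 (-y) (translateL2 x f)))
      hinj'.injOn,
    tsum_subtype _ fun γ : Γ =>
      frameSum (modulates g Δ) (translateL2 (-(γ : 𝔼 × ℝ).1) (translateL2 x f))]
  refine tsum_congr fun γ => ?_
  by_cases h : (γ : 𝔼 × ℝ).2 ∈ Set.Icc (-s) s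
  -- The window is symmetric, so the sign introduced by periodization is harmless.
  · have h' : 0 - (γ : 𝔼 × ℝ).2 ∈ Set.Icc (-s) s := by
      constructor <;> linarith [h.1, h.2]
    rw [Set.indicator_of_mem (by exact h)]
    simp only [Prod.fst_sub, Prod.snd_sub]
    rw [Set.indicator_of_mem h', translateL2_translateL2, neg_add_eq_sub]
    simp
  · have h' : 0 - (γ : 𝔼 × ℝ).2 ∉ Set.Icc (-s) s := fun h2 => h (by
      constructor <;> linarith [h2.1, h2.2])
    rw [Set.indicator_of_notMem (by exact h)]
    simp only [Prod.fst_sub, Prod.snd_sub]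
    rw [Set.indicator_of_notMem h']
    simp

theorem hullSum_add (s : ℝ) (f : L2 m) (v : EuclideanSpace ℝ (Fin m) × ℝ) (δ : Γ) :
    hullSum g Δ Γ s f (v + δ) = hullSum g Δ Γ s f v :=
  periodize_add Γ _ v δ

/-- The values of the hull sum over `p₂(Γ)` are frame sums of translates. -/
theorem hullSum_snd (hinj : Set.InjOn Prod.fst (Γ : Set (EuclideanSpace ℝ (Fin m) × ℝ)))
    (s : ℝ) (f : L2 m) (x : EuclideanSpace ℝ (Fin m)) (δ : Γ) :
    hullSum g Δ Γ s f (x, (δ : EuclideanSpace ℝ (Fin m) × ℝ).2)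
      = frameSum (gaborSystem g (modelSet Γ (Set.Icc (-s) s)) Δ)
          (translateL2 (x - (δ : EuclideanSpace ℝ (Fin m) × ℝ).1) f) := by
  rw [← hullSum_zero hinj, ← hullSum_add s f (_, 0) δ]
  congr 1
  ext1 <;> simp

/-- The interval of radius `s` about `v.2` is covered by finitely many windows of radius `a` centred
in `p₂(Γ)`. Each of these contributes a frame sum of a translate of `f`, which is finite by the
Bessel bound. -/
theorem hullSum_ne_top
    (hΓ : IsCutAndProject Γ) {a : ℝ} (ha : 0 < a)
    (hB : IsBesselWith 1 (gaborSystem g (modelSet Γ (Set.Icc (-a) a)) Δ))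
    (s : ℝ) (f : L2 m) (v : EuclideanSpace ℝ (Fin m) × ℝ) : hullSum g Δ Γ s f v ≠ ∞ := by
  obtain ⟨t, ht⟩ := (isCompact_Icc (a := v.2 - s) (b := v.2 + s)).elim_finite_subcover
    (fun γ : Γ => Metric.ball (γ : 𝔼 × ℝ).2 a) (fun _ => Metric.isOpen_ball) (fun r _ => by
      obtain ⟨_, h, ⟨γ, hγ, rfl⟩⟩ := Metric.dense_iff.1 hΓ.dense_snd r a ha
      exact Set.mem_iUnion.2 ⟨⟨γ, hγ⟩, Metric.mem_ball_comm.1 h⟩)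
  have hfin : ∀ δ : Γ, hullSum g Δ Γ a f (v.1, (δ : 𝔼 × ℝ).2) ≠ ∞ := fun δ => by
    rw [hullSum_snd hΓ.injOn_fst]
    refine ((hB _).trans_lt ?_).ne
    finiteness
  refine ((?_ : _ ≤ ∑ δ ∈ t, hullSum g Δ Γ a f (v.1, (δ : 𝔼 × ℝ).2)).trans_lt
    (ENNReal.sum_lt_top.2 fun δ _ => (hfin δ).lt_top)).ne
  simp only [hullSum, periodize, Prod.fst_sub, Prod.snd_sub]
  rw [← Summable.tsum_finsetSum fun _ _ => ENNReal.summable]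
  refine ENNReal.tsum_le_tsum fun γ => ?_
  rw [← Finset.mul_sum]
  refine mul_le_mul_right ?_ _
  by_cases h : v.2 - (γ : 𝔼 × ℝ).2 ∈ Set.Icc (-s) s
  · obtain ⟨δ, hδt, hδ⟩ := Set.mem_iUnion₂.1
      (ht (show (γ : 𝔼 × ℝ).2 ∈ _ by constructor <;> linarith [h.1, h.2]))
    rw [Metric.mem_ball, Real.dist_eq, abs_lt] at hδ
    have h' : (δ : 𝔼 × ℝ).2 - (γ : 𝔼 × ℝ).2 ∈ Set.Icc (-a) a := by
      constructor <;> linarith [hδ.1, hδ.2]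
    refine le_trans ?_ (Finset.single_le_sum (f := fun δ : Γ => (Set.Icc (-a) a).indicator
      (1 : ℝ → ℝ≥0∞) ((δ : 𝔼 × ℝ).2 - (γ : 𝔼 × ℝ).2)) (fun _ _ => zero_le) hδt)
    simp only [Set.indicator_of_mem h, Set.indicator_of_mem h', Pi.one_apply, le_refl]
  · simp [Set.indicator_of_notMem h]

/-- Dominated convergence on `Γ` with counting measure. For `|w - w₀| < 1` the window of radius `a +
1` at `w₀` dominates, and every term is locally constant at `w₀` because `w₀ - p₂γ` avoids the
window boundary. -/
theorem continuousAt_hullSum [Countable Γ] (hΓ : IsCutAndProject Γ) {a : ℝ} (ha : 0 < a)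
    (hB : IsBesselWith 1 (gaborSystem g (modelSet Γ (Set.Icc (-a) a)) Δ))
    (f : L2 m) (x : EuclideanSpace ℝ (Fin m)) {w₀ : ℝ}
    (hw₀ : ∀ γ : Γ, w₀ - (γ : EuclideanSpace ℝ (Fin m) × ℝ).2 ∉ frontier (Set.Icc (-a) a)) :
    ContinuousAt (fun w => hullSum g Δ Γ a f (x, w)) w₀ := by
  have hbd := hullSum_ne_top (f := f) hΓ ha hB (a + 1) (x, w₀)
  simp only [ContinuousAt, hullSum, periodize, Prod.fst_sub, Prod.snd_sub] at hbd ⊢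
  simp only [← lintegral_count] at hbd ⊢
  refine tendsto_lintegral_filter_of_dominated_convergence _
    (Eventually.of_forall fun w => measurable_of_countable _) ?_ hbd
    (Eventually.of_forall fun γ => ?_)
  · filter_upwards [Metric.ball_mem_nhds w₀ one_pos] with w hw
    refine Eventually.of_forall fun γ => mul_le_mul_right ?_ _
    rw [Metric.mem_ball, Real.dist_eq, abs_lt] at hw
    by_cases h : w - (γ : 𝔼 × ℝ).2 ∈ Set.Icc (-a) a
    · have h' : w₀ - (γ : 𝔼 × ℝ).2 ∈ Set.Icc (-(a + 1)) (a + 1) := by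
        constructor <;> linarith [h.1, h.2, hw.1, hw.2]
      simp only [Set.indicator_of_mem h, Set.indicator_of_mem h', Pi.one_apply, le_refl]
    · simp [Set.indicator_of_notMem h]
  · refine tendsto_const_nhds.congr' ?_
    have hcont : Tendsto (fun w : ℝ => w - (γ : 𝔼 × ℝ).2) (𝓝 w₀) (𝓝 (w₀ - (γ : 𝔼 × ℝ).2)) :=
      (continuous_id.sub continuous_const).tendsto w₀
    by_cases h : w₀ - (γ : 𝔼 × ℝ).2 ∈ Set.Icc (-a) a
    · have hint : w₀ - (γ : 𝔼 × ℝ).2 ∈ interior (Set.Icc (-a) a) := by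
        by_contra hn
        exact hw₀ γ ⟨subset_closure h, hn⟩
      filter_upwards [hcont (mem_interior_iff_mem_nhds.1 hint)] with w hw
      rw [Set.indicator_of_mem h, Set.indicator_of_mem (by exact hw)]
      rfl
    · filter_upwards [hcont (isClosed_Icc.isOpen_compl.mem_nhds h)] with w hw
      rw [Set.indicator_of_notMem h, Set.indicator_of_notMem (by exact hw)]

end

/-! ### From the hull sum to the frame sum, and the mean value -/

section

variable {m L : ℕ} {g : Fin L → L2 m} {Δ : Set (EuclideanSpace ℝ (Fin m))}
  {Γ : Submodule ℤ (EuclideanSpace ℝ (Fin m) × ℝ)}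

local notation "𝔼" => EuclideanSpace ℝ (Fin m)

theorem frontier_symm_Icc {a : ℝ} (ha : 0 < a) : frontier (Set.Icc (-a) a) = {-a, a} :=
  frontier_Icc (by linarith)

theorem ae_notMem_frontier [Countable Γ] {a : ℝ} (ha : 0 < a) :
    ∀ᵐ v : EuclideanSpace ℝ (Fin m) × ℝ, ∀ γ : Γ,
      v.2 - (γ : EuclideanSpace ℝ (Fin m) × ℝ).2 ∉ frontier (Set.Icc (-a) a) := by
  rw [Measure.volume_eq_prod]
  refine Measure.quasiMeasurePreserving_snd.ae (p := fun w : ℝ => ∀ γ : Γ,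
    w - (γ : 𝔼 × ℝ).2 ∉ frontier (Set.Icc (-a) a)) (ae_all_iff.2 fun γ => ?_)
  have hne : ∀ s : ℝ, ∀ᵐ w : ℝ, w ≠ s := fun s => by simp [ae_iff]
  filter_upwards [hne (-a + (γ : 𝔼 × ℝ).2), hne (a + (γ : 𝔼 × ℝ).2)] with w h1 h2
  rw [frontier_symm_Icc ha]
  rintro (h | h)
  · exact h1 (by linarith)
  · exact h2 (by linarith [show w - (γ : 𝔼 × ℝ).2 = a from h])

/-- A closed condition satisfied by the frame sums of all translates is satisfied a.e. by the
hull sum. -/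
theorem ae_hullSum_mem [Countable Γ] (hΓ : IsCutAndProject Γ) {a : ℝ} (ha : 0 < a)
    (hB : IsBesselWith 1 (gaborSystem g (modelSet Γ (Set.Icc (-a) a)) Δ)) (f : L2 m)
    {S : Set ℝ≥0∞} (hS : IsClosed S)
    (h : ∀ x, frameSum (gaborSystem g (modelSet Γ (Set.Icc (-a) a)) Δ) (translateL2 x f) ∈ S) :
    ∀ᵐ v, hullSum g Δ Γ a f v ∈ S := by
  filter_upwards [ae_notMem_frontier (Γ := Γ) ha] with v hv
  have hc := (continuousAt_hullSum hΓ ha hB f v.1 hv).continuousWithinAt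
    (s := Prod.snd '' (Γ : Set (𝔼 × ℝ)))
  -- The value at `v` is a limit of values over `p₂(Γ)`, all of which lie in `S`.
  have hm := hc.mem_closure_image (hΓ.dense_snd v.2)
  refine (hS.closure_subset_iff.2 ?_) hm
  rintro _ ⟨_, ⟨δ, hδ, rfl⟩, rfl⟩
  have hsnd := hullSum_snd (g := g) (Δ := Δ) hΓ.injOn_fst a f v.1 ⟨δ, hδ⟩
  simp only at hsnd ⊢
  rw [hsnd]
  exact h _

/-- If the hull sum equals `‖f‖²` a.e., then so does the frame sum at `f`. -/
theorem le_frameSum_of_ae_hullSum [Countable Γ] (hΓ : IsCutAndProject Γ) {a : ℝ} (ha : 0 < a)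
    (hgen : Disjoint (frontier (Set.Icc (-a) a))
      (Prod.snd '' (Γ : Set (EuclideanSpace ℝ (Fin m) × ℝ))))
    (hB : IsBesselWith 1 (gaborSystem g (modelSet Γ (Set.Icc (-a) a)) Δ)) (f : L2 m)
    (h : ∀ᵐ v, hullSum g Δ Γ a f v = ‖f‖ₑ ^ 2) :
    ‖f‖ₑ ^ 2 ≤ frameSum (gaborSystem g (modelSet Γ (Set.Icc (-a) a)) Δ) f := by
  set e := gaborSystem g (modelSet Γ (Set.Icc (-a) a)) Δ with he
  have hsqrt : (‖f‖ₑ ^ 2) ^ (2⁻¹ : ℝ) = ‖f‖ₑ := by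
    rw [← ENNReal.rpow_natCast, ← ENNReal.rpow_mul]
    norm_num
  -- Since `-p₂γ = p₂(-γ)`, genericity makes `w = 0` a point of continuity.
  have h0 : ∀ γ : Γ, 0 - (γ : 𝔼 × ℝ).2 ∉ frontier (Set.Icc (-a) a) := fun γ hγ =>
    Set.disjoint_left.1 hgen hγ ⟨-γ, Γ.neg_mem γ.2, by simp⟩
  rw [Measure.volume_eq_prod] at h
  have h1 : ∀ᵐ x : 𝔼, frameSum e (translateL2 x f) = ‖f‖ₑ ^ 2 := by
    filter_upwards [Measure.ae_ae_of_ae_prod h] with x hx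
    have hc := (continuousAt_hullSum hΓ ha hB f x h0).continuousWithinAt
      (s := {w | hullSum g Δ Γ a f (x, w) = ‖f‖ₑ ^ 2})
    have hm := hc.mem_closure_image (Measure.dense_of_ae hx 0)
    have hsub := (isClosed_singleton (x := ‖f‖ₑ ^ 2)).closure_subset_iff.2
      (show (fun w => hullSum g Δ Γ a f (x, w)) '' {w | hullSum g Δ Γ a f (x, w) = ‖f‖ₑ ^ 2} ⊆ _ by
        rintro _ ⟨w, hw, rfl⟩
        exact hw) hm
    rw [he, ← hullSum_zero hΓ.injOn_fst]
    exact hsub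
  -- The point `x = 0` may be missed by `h1`. The Bessel bound makes the square root of the frame
  -- sum 1-Lipschitz, which yields a closed condition on `x` that holds on a dense set.
  have h2 : ∀ x : 𝔼, ‖f‖ₑ ≤ frameSum e f ^ (2⁻¹ : ℝ) + ‖translateL2 x f - f‖ₑ := by
    have hcl : IsClosed {x : 𝔼 | ‖f‖ₑ ≤ frameSum e f ^ (2⁻¹ : ℝ) + ‖translateL2 x f - f‖ₑ} :=
      isClosed_le continuous_const
        (continuous_const.add ((continuous_translateL2 f).sub continuous_const).enorm)
    refine fun x => (hcl.closure_subset_iff.2 ?_) (Measure.dense_of_ae h1 x)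
    intro y hy
    calc ‖f‖ₑ = frameSum e (f + (translateL2 y f - f)) ^ (2⁻¹ : ℝ) := by
          rw [add_sub_cancel, show frameSum e (translateL2 y f) = _ from hy, hsqrt]
      _ ≤ _ := (sqrt_frameSum_add_le e f _).trans (by gcongr; exact hB.sqrt_frameSum_le _)
  have h3 := h2 0
  rw [translateL2_zero, sub_self, enorm_zero, add_zero] at h3
  calc ‖f‖ₑ ^ 2 ≤ (frameSum e f ^ (2⁻¹ : ℝ)) ^ 2 := by gcongr
    _ = frameSum e f := by
      rw [← ENNReal.rpow_natCast, ← ENNReal.rpow_mul]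
      norm_num

/-! ### The mean of the hull sum -/

theorem measurable_frameSum_modulates (hΔ : Δ.Countable) (f : L2 m) :
    Measurable fun x : EuclideanSpace ℝ (Fin m) => frameSum (modulates g Δ) (translateL2 x f) := by
  have := hΔ.to_subtype
  refine Measurable.tsum fun p => ?_
  have hc : Continuous fun x : 𝔼 => ‖(inner ℂ (modulates g Δ p) (translateL2 x f) : ℂ)‖ₑ ^ 2 :=
    (ENNReal.continuous_pow 2).comp
      (continuous_const.inner (continuous_translateL2 f)).enorm
  exact hc.measurable

theorem measurable_fourier_sum (hΔ : Δ.Countable)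
    (hg : ∀ l, Integrable (g l : EuclideanSpace ℝ (Fin m) → ℂ)) :
    Measurable fun t : EuclideanSpace ℝ (Fin m) => ∑ l : Fin L, ∑' b : Δ,
      ‖𝓕 (g l : EuclideanSpace ℝ (Fin m) → ℂ) (t - (b : EuclideanSpace ℝ (Fin m)))‖ₑ ^ 2 := by
  have := hΔ.to_subtype
  refine Finset.measurable_sum _ fun l _ => Measurable.tsum fun b => ?_
  have hc : Continuous fun t : 𝔼 => ‖𝓕 (g l : 𝔼 → ℂ) (t - b)‖ₑ ^ 2 :=
    (ENNReal.continuous_pow 2).comp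
      ((continuous_fourier_of_integrable (hg l)).comp (by fun_prop)).enorm
  exact hc.measurable

/-- Translating `f` by `x` amounts to translating the atom by `-x`; a reflection in `x` then reduces
each term to Plancherel, and countability of `Δ` allows the interchange of sum and integral. -/
theorem lintegral_frameSum_modulates (hΔ : Δ.Countable)
    (hg : ∀ l, Integrable (g l : EuclideanSpace ℝ (Fin m) → ℂ)) (f : L2 m) :
    ∫⁻ x : EuclideanSpace ℝ (Fin m), frameSum (modulates g Δ) (translateL2 x f)
      = ∫⁻ t, ‖(𝓕 f : L2 m) t‖ₑ ^ 2 * ∑ l : Fin L, ∑' b : Δ,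
        ‖𝓕 (g l : EuclideanSpace ℝ (Fin m) → ℂ) (t - (b : EuclideanSpace ℝ (Fin m)))‖ₑ ^ 2 := by
  have := hΔ.to_subtype
  have hc : ∀ p : Fin L × Δ, Continuous fun x : 𝔼 =>
      ‖(inner ℂ (modulates g Δ p) (translateL2 x f) : ℂ)‖ₑ ^ 2 := fun p =>
    (ENNReal.continuous_pow 2).comp (continuous_const.inner (continuous_translateL2 f)).enorm
  have hF : AEMeasurable fun t : 𝔼 => ‖(𝓕 f : L2 m) t‖ₑ ^ 2 :=
    (Lp.aestronglyMeasurable _).enorm.pow_const 2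
  have hĝ : ∀ p : Fin L × Δ, Continuous fun t : 𝔼 => ‖𝓕 (g p.1 : 𝔼 → ℂ) (t - p.2)‖ₑ ^ 2 :=
    fun p => (ENNReal.continuous_pow 2).comp
      ((continuous_fourier_of_integrable (hg p.1)).comp (by fun_prop)).enorm
  calc ∫⁻ x : 𝔼, frameSum (modulates g Δ) (translateL2 x f)
      = ∑' p : Fin L × Δ, ∫⁻ x : 𝔼, ‖(inner ℂ (modulates g Δ p) (translateL2 x f) : ℂ)‖ₑ ^ 2 :=
        lintegral_tsum fun p => (hc p).aemeasurable
    _ = ∑' p : Fin L × Δ, ∫⁻ t, ‖(𝓕 f : L2 m) t‖ₑ ^ 2 * ‖𝓕 (g p.1 : 𝔼 → ℂ) (t - p.2)‖ₑ ^ 2 := by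
        refine tsum_congr fun p => ?_
        rw [← lintegral_inner_gaborAtom_sq (p.2 : 𝔼) (hg p.1) f,
          ← (Measure.measurePreserving_neg (volume : Measure 𝔼)).lintegral_comp_emb
            (MeasurableEquiv.neg 𝔼).measurableEmbedding]
        refine lintegral_congr fun x => ?_
        rw [inner_translateL2_left]
        rfl
    _ = ∫⁻ t, ∑' p : Fin L × Δ, ‖(𝓕 f : L2 m) t‖ₑ ^ 2 * ‖𝓕 (g p.1 : 𝔼 → ℂ) (t - p.2)‖ₑ ^ 2 :=
        (lintegral_tsum fun p => hF.mul (hĝ p).aemeasurable).symm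
    _ = _ := by
        simp_rw [ENNReal.tsum_mul_left, ENNReal.tsum_prod', tsum_fintype]

/-- Unfolding replaces the domain by all of `ℝ^m × ℝ`, where the summand is a product: one factor
gives the Plancherel integral, the other the window length. -/
theorem setLIntegral_hullSum [DiscreteTopology Γ] [IsZLattice ℝ Γ]
    {D : Set (EuclideanSpace ℝ (Fin m) × ℝ)} (hD : IsAddFundamentalDomain Γ D volume)
    (hΔ : Δ.Countable) (hg : ∀ l, Integrable (g l : EuclideanSpace ℝ (Fin m) → ℂ)) (a : ℝ)
    (f : L2 m) :
    ∫⁻ v in D, hullSum g Δ Γ a f v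
      = (∫⁻ t, ‖(𝓕 f : L2 m) t‖ₑ ^ 2 * ∑ l : Fin L, ∑' b : Δ,
        ‖𝓕 (g l : EuclideanSpace ℝ (Fin m) → ℂ) (t - (b : EuclideanSpace ℝ (Fin m)))‖ₑ ^ 2) *
        ENNReal.ofReal (2 * a) := by
  have h1 := measurable_frameSum_modulates (g := g) hΔ f
  have h2 : Measurable ((Set.Icc (-a) a).indicator (1 : ℝ → ℝ≥0∞)) :=
    measurable_one.indicator measurableSet_Icc
  have h3 : Measurable fun u : 𝔼 × ℝ => frameSum (modulates g Δ) (translateL2 u.1 f) *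
      (Set.Icc (-a) a).indicator (1 : ℝ → ℝ≥0∞) u.2 :=
    (h1.comp measurable_fst).mul (h2.comp measurable_snd)
  rw [hullSum, setLIntegral_periodize hD h3,
    Measure.volume_eq_prod, lintegral_prod_mul h1.aemeasurable h2.aemeasurable,
    lintegral_frameSum_modulates hΔ hg, lintegral_indicator_one measurableSet_Icc, Real.volume_Icc]
  congr 3
  ring

/-- A measurable weight that preserves all `L²` norms is `1` a.e. -/
theorem ae_eq_one_of_forall_lintegral {G : EuclideanSpace ℝ (Fin m) → ℝ≥0∞} (hG : Measurable G)
    (h : ∀ f : L2 m, ∫⁻ t, ‖f t‖ₑ ^ 2 * G t = ‖f‖ₑ ^ 2) : ∀ᵐ t, G t = 1 := by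
  refine ae_eq_of_forall_setLIntegral_eq_of_sigmaFinite hG measurable_one fun S hS hSfin => ?_
  have h1 := h (indicatorConstLp 2 hS hSfin.ne 1)
  rw [enorm_sq_eq_lintegral] at h1
  have h2 : ∀ᵐ t : 𝔼, ‖(indicatorConstLp 2 hS hSfin.ne (1 : ℂ) : L2 m) t‖ₑ ^ 2
      = S.indicator 1 t := by
    filter_upwards [indicatorConstLp_coeFn (p := 2) (hs := hS) (hμs := hSfin.ne) (c := (1 : ℂ))]
      with t ht
    rw [ht]
    by_cases hm : t ∈ S <;> simp [hm]
  rw [lintegral_congr_ae (g := S.indicator 1) h2,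
    lintegral_congr_ae (g := S.indicator G) (by
      filter_upwards [h2] with t ht
      rw [ht]
      by_cases hm : t ∈ S <;> simp [hm]),
    lintegral_indicator hS, lintegral_indicator hS] at h1
  exact h1

/-- A window that is a symmetric interval has the form `[-a, a]`. -/
theorem exists_eq_symm_Icc {Ω : Set ℝ} (hΩ : IsWindow Ω) (hc : Ω.OrdConnected) (hs : -Ω = Ω) :
    ∃ a : ℝ, 0 < a ∧ Ω = Set.Icc (-a) a := by
  have hIcc := eq_Icc_of_connected_compact ⟨hΩ.nonempty, hc.isPreconnected⟩ hΩ.isCompact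
  have hinf : sInf Ω = -sSup Ω := by
    conv_lhs => rw [← hs]
    exact Real.sInf_neg Ω
  rw [hinf] at hIcc
  refine ⟨sSup Ω, ?_, hIcc⟩
  -- Otherwise the interval has empty interior, so it cannot be the nonempty closure of its
  -- interior.
  by_contra h
  have h1 : interior Ω = ∅ := by
    rw [hIcc, interior_Icc, Set.Ioo_eq_empty]
    linarith
  have h2 := hΩ.closure_interior
  rw [h1, closure_empty] at h2
  exact hΩ.nonempty.ne_empty h2.symm

end

end GaborModelSet

/-! ### The characterization of tight frames -/

open GaborModelSet in
theorem corollary5p2 {m L : ℕ}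
    (Γ : Submodule ℤ (EuclideanSpace ℝ (Fin m) × ℝ)) [DiscreteTopology Γ] [IsZLattice ℝ Γ]
    (Ω : Set ℝ) (hΓΩ : GaborModelSet.IsSimpleGenericSymmetric Γ Ω)
    (Δ : Set (EuclideanSpace ℝ (Fin m)))
    (hΔd : GaborModelSet.IsRelativelyDense Δ) (hΔu : GaborModelSet.IsUniformlyDiscrete Δ)
    (g : Fin L → GaborModelSet.L2 m) (hg : ∀ l, GaborModelSet.MemAmalgam 2 (g l)) :
    GaborModelSet.HasDensity (GaborModelSet.modelSet Γ Ω)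
        (GaborModelSet.density (GaborModelSet.modelSet Γ Ω)) ∧
      (GaborModelSet.IsNormalizedTightFrame
          (GaborModelSet.gaborSystem g (GaborModelSet.modelSet Γ Ω) Δ) ↔
        GaborModelSet.IsBesselWith 1
            (GaborModelSet.gaborSystem g (GaborModelSet.modelSet Γ Ω) Δ) ∧
          ∀ᵐ t : EuclideanSpace ℝ (Fin m),
            ENNReal.ofReal (GaborModelSet.density (GaborModelSet.modelSet Γ Ω)) *
              ∑ l : Fin L, ∑' b : Δ,
                ‖𝓕 (g l : EuclideanSpace ℝ (Fin m) → ℂ) (t - (b : EuclideanSpace ℝ (Fin m)))‖ₑ ^ 2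
              = 1) := by
  obtain ⟨a, ha, rfl⟩ := exists_eq_symm_Icc hΓΩ.isWindow hΓΩ.interval hΓΩ.symmetric
  have hΓ := hΓΩ.isCutAndProject
  have hΔ := hΔu.countable
  have hgi := fun l => (hg l).integrable
  obtain ⟨D, hD, hD0, hDtop, -, -⟩ :=
    exists_fundamentalDomain Γ (volume : Measure (EuclideanSpace ℝ (Fin m) × ℝ))
  have hdens := hasDensity_modelSet hΓ hD hD0 hDtop ha
  rw [hdens.density_eq]
  refine ⟨hdens, ?_⟩
  set e := gaborSystem g (modelSet Γ (Set.Icc (-a) a)) Δ with he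
  set d := ENNReal.ofReal (2 * a / volume.real D) with hd
  set G : EuclideanSpace ℝ (Fin m) → ℝ≥0∞ := fun t => ∑ l : Fin L, ∑' b : Δ,
    ‖𝓕 (g l : EuclideanSpace ℝ (Fin m) → ℂ) (t - (b : EuclideanSpace ℝ (Fin m)))‖ₑ ^ 2 with hG
  have hGm : Measurable G := measurable_fourier_sum hΔ hgi
  have hdD : ENNReal.ofReal (2 * a) = d * volume D := by
    rw [hd, measureReal_def, ENNReal.ofReal_div_of_pos (ENNReal.toReal_pos hD0 hDtop), ENNReal.ofReal_toReal hDtop,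
      ENNReal.div_mul_cancel hD0 hDtop]
  have hmean : ∀ f : L2 m, ∫⁻ v in D, hullSum g Δ Γ a f v
      = (∫⁻ t, ‖(𝓕 f : L2 m) t‖ₑ ^ 2 * (d * G t)) * volume D := fun f => by
    rw [setLIntegral_hullSum hD hΔ hgi, hdD, ← mul_assoc,
      ← lintegral_mul_const' _ _ ENNReal.ofReal_ne_top]
    congr 2
    ext t
    rw [mul_assoc, mul_comm _ d]
  constructor
  · intro hT
    rw [isNormalizedTightFrame_iff] at hT
    have hB : IsBesselWith 1 e := fun f => by rw [hT f, ENNReal.coe_one, one_mul]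
    refine ⟨hB, ae_eq_one_of_forall_lintegral (hGm.const_mul d) fun h => ?_⟩
    -- Using `𝓕⁻ h` as test vector lets the Fourier-side function `h` be arbitrary in `L²`.
    have h1 := ae_hullSum_mem hΓ ha hB (𝓕⁻ h) (isClosed_singleton (x := ‖(𝓕⁻ h : L2 m)‖ₑ ^ 2))
      fun x => by rw [Set.mem_singleton_iff, hT, enorm_translateL2]
    have h2 := hmean (𝓕⁻ h)
    rw [FourierTransform.fourier_fourierInv_eq, lintegral_congr_ae (ae_restrict_of_ae h1),
      setLIntegral_const] at h2
    rw [← (ENNReal.mul_left_inj hD0 hDtop).1 h2, ← ofReal_norm, ← ofReal_norm,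
      ← Lp.norm_fourier_eq, FourierTransform.fourier_fourierInv_eq]
  · rintro ⟨hB, hdiag⟩
    rw [isNormalizedTightFrame_iff]
    intro f
    have hle : ∀ h : L2 m, frameSum e h ≤ ‖h‖ₑ ^ 2 := fun h => by simpa using hB h
    refine le_antisymm (hle f) (le_frameSum_of_ae_hullSum hΓ ha hΓΩ.generic hB f ?_)
    have h1 := ae_hullSum_mem hΓ ha hB f (isClosed_Iic (a := ‖f‖ₑ ^ 2))
      fun x => (hle _).trans_eq (by rw [enorm_translateL2])
    have h2 : ∫⁻ v in D, hullSum g Δ Γ a f v = ‖f‖ₑ ^ 2 * volume D := by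
      rw [hmean, lintegral_congr_ae (g := fun t => ‖(𝓕 f : L2 m) t‖ₑ ^ 2), ← enorm_sq_eq_lintegral,
        ← ofReal_norm, Lp.norm_fourier_eq, ofReal_norm]
      filter_upwards [hdiag] with t ht
      rw [ht, mul_one]
    -- By periodicity equality is needed only on `D`, where an a.e. inequality between functions
    -- with equal finite integrals is an equality a.e.
    refine ae_of_ae_fundamentalDomain hD (fun v δ => by rw [hullSum_add]) ?_
    refine ae_eq_of_ae_le_of_lintegral_le (ae_restrict_of_ae h1) ?_ aemeasurable_const ?_
    · rw [h2]
      finiteness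
    · rw [h2, setLIntegral_const]
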